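/- Let $t=(t_1,t_2,t_3,\dots)$ be a sequence of complex times and put $\xi(t,\lambda)=\sum_{k\ge1}t_k\lambda^k$ for $\lambda\in\mathbb R$. Let $\mathcal D$ be the set of those $t$ for which everything converges absolutely, that is: $\sum_k|t_k|r^k<\infty$ for all $r\ge0$, and for every $n\ge0$ $$\int_{\mathbb R}|\lambda|^n\Bigl(1+\sum_{k\ge1}k|t_k||\lambda|^k\Bigr)\bigl|e^{\xi(t,\lambda)}\bigr|\,d\lambda<\infty .$$ For a function $F$ on $\mathcal D$ let $\partial F/\partial t_k$ denote the complex derivative of $F$ in the single variable $t_k$ (the other times being fixed), taken within $\mathcal D$; this is unambiguous because $t\in\mathcal D$ implies $(t_1,\dots,t_k+iy,\dots)\in\mathcal D$ for all $y\in\mathbb R$. Write $\partial=\partial/\partial t_1$. Let $c\in\mathbb C$ and let $$\phi(t)=\int_{\mathbb R}c\,e^{\xi(t,\lambda)}\,d\lambda$$ be the spectral integral with constant density $\phi^{(0)}(\lambda)=c$. For $N\ge0$ let $$W_N=W_N[\phi,\partial\phi,\dots,\partial^{N-1}\phi]=\det\bigl(\partial^{\,i-1}\partial^{\,j-1}\phi\bigr)_{i,j=1,\dots,N}$$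 (with $W_0=1$) be the Wronskian $\tau$-function of the generalized Burgers–Hopf hierarchy. Define the one-matrix-model Virasoro operators $$\mathcal L^{(N)}_{-1}=\sum_{k\ge2}k\,t_k\frac{\partial}{\partial t_{k-1}}+N\,t_1,\qquad \mathcal L^{(N)}_0=\sum_{k\ge1}k\,t_k\frac{\partial}{\partial t_k}+N^2,$$ $$\mathcal L^{(N)}_s=\sum_{k\ge1}k\,t_k\frac{\partial}{\partial t_{k+s}}+2N\frac{\partial}{\partial t_s}+\sum_{k=1}^{s-1}\frac{\partial}{\partial t_k}\frac{\partial}{\partial t_{s-k}}\qquad(s\ge1).$$ Then all iterated partial derivatives of $\phi$ and of $W_N$ exist throughout $\mathcal D$, and for every integer $s\ge-1$ and every $t\in\mathcal D$ the infinite sum over $k$ in $\mathcal L^{(N)}_sW_N(t)$ converges absolutely and $$\mathcal L^{(N)}_s\,W_N[\phi,\partial\phi,\dots,\partial^{N-1}\phi](t)=0 .$$ -/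

import Mathlib

open MeasureTheory

namespace BurgersHopf

noncomputable section

/-- `ξ(t, x) = ∑_{k ≥ 1} t_k x ^ k` for a real spectral parameter `x`. A sequence of complex times
`t_1, t_2, t_3, …` is a function `t : ℕ → ℂ`; the entry `t 0` is a dummy that enters nowhere. -/
def xi (t : ℕ → ℂ) (x : ℝ) : ℂ := ∑' k : ℕ, t (k + 1) * (x : ℂ) ^ (k + 1)

/-- The times for which all objects of the theory converge absolutely: the series `ξ(t, ·)` is
entire, all moments `∫ x ^ n * exp (ξ(t, x)) dx` converge absolutely, and they still do after
multiplication by `∑_k k |t_k| |x| ^ k`. For sequences with finitely many nonzero entries the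
last condition follows from the second one. -/
structure Convergent (t : ℕ → ℂ) : Prop where
  summable : ∀ r : ℝ, Summable fun k : ℕ => ‖t k‖ * r ^ k
  moments : ∀ n : ℕ, Integrable fun x : ℝ => (x : ℂ) ^ n * Complex.exp (xi t x)
  weighted : ∀ n : ℕ, Integrable fun x : ℝ =>
    (∑' k : ℕ, (k : ℝ) * ‖t k‖ * |x| ^ k) * ‖(x : ℂ) ^ n * Complex.exp (xi t x)‖

/-- The values that the single time `t_k` may take, the others being fixed. -/
def slice (k : ℕ) (t : ℕ → ℂ) : Set ℂ := {z | Convergent (Function.update t k z)}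

/-- The partial derivative `∂F/∂t_k`: the complex derivative in the variable `t_k`, taken
within the domain of convergence. -/
def pderiv (k : ℕ) (F : (ℕ → ℂ) → ℂ) : (ℕ → ℂ) → ℂ := fun t =>
  derivWithin (fun z => F (Function.update t k z)) (slice k t) (t k)

/-- The partial derivative `∂F/∂t_k` exists at `t`. -/
def HasPartial (k : ℕ) (F : (ℕ → ℂ) → ℂ) (t : ℕ → ℂ) : Prop :=
  DifferentiableWithinAt ℂ (fun z => F (Function.update t k z)) (slice k t) (t k)

/-- All iterated partial derivatives of `F`, of every order and in all the times, exist throughout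
the domain of convergence. -/
def Smooth (F : (ℕ → ℂ) → ℂ) : Prop :=
  ∀ l : List ℕ, (∀ j ∈ l, 1 ≤ j) → ∀ k : ℕ, 1 ≤ k → ∀ t : ℕ → ℂ, Convergent t →
    HasPartial k (l.foldr pderiv F) t

/-- `φ(t) = ∫ ρ(x) exp (ξ(t, x)) dx`, with density `ρ`. -/
def spectralIntegral (ρ : ℝ → ℂ) (t : ℕ → ℂ) : ℂ := ∫ x : ℝ, ρ x * Complex.exp (xi t x)

/-- The Wronskian `W_N[f_1, …, f_N] = det (∂ ^ (i - 1) f_j)`, where `∂ = ∂/∂t_1`. -/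
def wronskian {N : ℕ} (f : Fin N → (ℕ → ℂ) → ℂ) (t : ℕ → ℂ) : ℂ :=
  (Matrix.of fun i j : Fin N => (pderiv 1)^[(i : ℕ)] (f j) t).det

/-- `W_N[φ, ∂φ, …, ∂ ^ (N - 1) φ]`. -/
def tau (N : ℕ) (φ : (ℕ → ℂ) → ℂ) : (ℕ → ℂ) → ℂ :=
  wronskian fun j : Fin N => (pderiv 1)^[(j : ℕ)] φ

/-- The `k`-th term `k t_k ∂F/∂t_{k+s}` of the infinite sum in the Virasoro operator of index
`s ≥ -1`. The sum runs over `k ≥ 2` if `s = -1` and over `k ≥ 1` otherwise. -/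
def eulerTerm (s : ℤ) (F : (ℕ → ℂ) → ℂ) (t : ℕ → ℂ) (k : ℕ) : ℂ :=
  if 1 ≤ k ∧ 1 ≤ (k : ℤ) + s then (k : ℂ) * t k * pderiv ((k : ℤ) + s).toNat F t else 0

/-- The finite part of the Virasoro operator of index `s ≥ -1`: `N t_1` for `s = -1`, `N ^ 2` for
`s = 0`, and `2 N ∂/∂t_s + ∑_{k=1}^{s-1} ∂/∂t_k ∂/∂t_{s-k}` for `s ≥ 1`. -/
def virasoroRest (N : ℕ) (s : ℤ) (F : (ℕ → ℂ) → ℂ) (t : ℕ → ℂ) : ℂ :=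
  if s = -1 then (N : ℂ) * t 1 * F t
  else if s = 0 then (N : ℂ) ^ 2 * F t
  else 2 * (N : ℂ) * pderiv s.toNat F t +
    ∑ k ∈ Finset.Ico 1 s.toNat, pderiv k (pderiv (s.toNat - k) F) t

/-- The one-matrix-model Virasoro operator `L_s^{(N)}`, `s ≥ -1`. -/
def virasoro (N : ℕ) (s : ℤ) (F : (ℕ → ℂ) → ℂ) (t : ℕ → ℂ) : ℂ :=
  (∑' k : ℕ, eulerTerm s F t k) + virasoroRest N s F t

lemma Convergent.summable_xi {t : ℕ → ℂ} (ht : Convergent t) (x : ℝ) :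
    Summable fun k : ℕ => t (k + 1) * (x : ℂ) ^ (k + 1) := by
  have h := (summable_nat_add_iff (f := fun k : ℕ => ‖t k‖ * |x| ^ k) 1).2 (ht.summable |x|)
  refine Summable.of_norm (h.congr fun k => ?_)
  simp

lemma Convergent.summable_weight {t : ℕ → ℂ} (ht : Convergent t) (x : ℝ) :
    Summable fun k : ℕ => (k : ℝ) * ‖t k‖ * |x| ^ k := by
  refine Summable.of_nonneg_of_le (fun k => by positivity) (fun k => ?_)
    (ht.summable (2 * |x|))
  have hk : (k : ℝ) ≤ 2 ^ k := by exact_mod_cast Nat.lt_two_pow_self.le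
  calc (k : ℝ) * ‖t k‖ * |x| ^ k = (k : ℝ) * (‖t k‖ * |x| ^ k) := by ring
    _ ≤ 2 ^ k * (‖t k‖ * |x| ^ k) := by gcongr
    _ = ‖t k‖ * (2 * |x|) ^ k := by rw [mul_pow]; ring

lemma update_eq_add_single (t : ℕ → ℂ) (k : ℕ) (z : ℂ) (j : ℕ) :
    Function.update t k z j = t j + if j = k then z - t k else 0 := by
  by_cases h : j = k
  · subst h; simp
  · simp [h]

lemma Convergent.xi_update {t : ℕ → ℂ} (ht : Convergent t) {k : ℕ} (hk : 1 ≤ k) (z : ℂ) (x : ℝ) :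
    xi (Function.update t k z) x = xi t x + (z - t k) * (x : ℂ) ^ k := by
  obtain ⟨m, rfl⟩ : ∃ m, k = m + 1 := ⟨k - 1, by omega⟩
  have h1 := (ht.summable_xi x).hasSum
  have h2 := hasSum_ite_eq m ((z - t (m + 1)) * (x : ℂ) ^ (m + 1))
  have h3 := h1.add h2
  have h4 : (fun j : ℕ => Function.update t (m + 1) z (j + 1) * (x : ℂ) ^ (j + 1)) =
      fun j : ℕ => t (j + 1) * (x : ℂ) ^ (j + 1) +
        if j = m then (z - t (m + 1)) * (x : ℂ) ^ (m + 1) else 0 := by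
    funext j
    rw [update_eq_add_single]
    by_cases h : j = m
    · subst h; simp; ring
    · simp [h]
  rw [xi, h4]
  exact h3.tsum_eq

/-- Imaginary shifts of a single time do not leave the domain of convergence. -/
lemma Convergent.update_imaginary {t : ℕ → ℂ} (ht : Convergent t) {k : ℕ} (hk : 1 ≤ k) (y : ℝ) :
    Convergent (Function.update t k (t k + y * Complex.I)) := by
  have hxi : ∀ x : ℝ, xi (Function.update t k (t k + y * Complex.I)) x =
      xi t x + ((y * x ^ k : ℝ) : ℂ) * Complex.I := fun x => by
    rw [ht.xi_update hk]; push_cast; ring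
  have hnorm : ∀ (n : ℕ) (x : ℝ),
      ‖(x : ℂ) ^ n * Complex.exp (xi (Function.update t k (t k + y * Complex.I)) x)‖ =
        ‖(x : ℂ) ^ n * Complex.exp (xi t x)‖ := fun n x => by
    rw [hxi, Complex.exp_add, norm_mul, norm_mul, norm_mul, Complex.norm_exp_ofReal_mul_I, mul_one]
  have hup : ∀ j, ‖Function.update t k (t k + y * Complex.I) j‖ =
      ‖t j‖ + if j = k then ‖t k + y * Complex.I‖ - ‖t k‖ else 0 := fun j => by
    by_cases h : j = k
    · subst h; simp
    · simp [h]
  refine ⟨fun r => ?_, fun n => ?_, fun n => ?_⟩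
  · have h := (ht.summable r).add
      (hasSum_ite_eq k ((‖t k + y * Complex.I‖ - ‖t k‖) * r ^ k)).summable
    refine h.congr fun j => ?_
    rw [hup]
    by_cases hj : j = k
    · subst hj; simp; ring
    · simp [hj]
  · have h := (ht.moments n).bdd_mul (c := 1)
      (f := fun x : ℝ => Complex.exp (((y * x ^ k : ℝ) : ℂ) * Complex.I))
      (Continuous.aestronglyMeasurable (by fun_prop)) (Filter.Eventually.of_forall fun x => by
        rw [Complex.norm_exp_ofReal_mul_I])
    refine h.congr (Filter.Eventually.of_forall fun x => ?_)
    simp only [hxi, Complex.exp_add]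
    ring
  · have h := (ht.weighted n).add
      (((ht.moments (n + k)).norm).const_mul ((k : ℝ) * (‖t k + y * Complex.I‖ - ‖t k‖)))
    refine h.congr (Filter.Eventually.of_forall fun x => ?_)
    have hs := (ht.summable_weight x).hasSum.add
      (hasSum_ite_eq k ((k : ℝ) * (‖t k + y * Complex.I‖ - ‖t k‖) * |x| ^ k))
    have he : (∑' j : ℕ, (j : ℝ) * ‖Function.update t k (t k + y * Complex.I) j‖ * |x| ^ j) =
        (∑' j : ℕ, (j : ℝ) * ‖t j‖ * |x| ^ j) +
          (k : ℝ) * (‖t k + y * Complex.I‖ - ‖t k‖) * |x| ^ k := by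
      rw [← hs.tsum_eq]
      congr 1
      funext j
      rw [hup]
      by_cases hj : j = k
      · subst hj; simp; ring
      · simp [hj]
    simp only [Pi.add_apply]
    rw [he, hnorm]
    simp only [norm_mul, norm_pow, Complex.norm_real, Real.norm_eq_abs, pow_add]
    ring

/-- Inside the domain of convergence each partial derivative is unambiguous: the current value of
`t_k` is never an isolated point of its slice. -/
theorem uniqueDiffWithinAt_slice {t : ℕ → ℂ} (ht : Convergent t) {k : ℕ} (hk : 1 ≤ k) :
    UniqueDiffWithinAt ℂ (slice k t) (t k) := by
  rw [uniqueDiffWithinAt_iff_accPt, accPt_iff_nhds]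
  intro U hU
  have hc : Filter.Tendsto (fun y : ℝ => t k + y * Complex.I) (nhds 0) (nhds (t k)) := by
    have : Continuous fun y : ℝ => t k + y * Complex.I := by fun_prop
    simpa using this.tendsto 0
  obtain ⟨ε, hε, h⟩ := Metric.eventually_nhds_iff.1 (hc.eventually hU)
  refine ⟨t k + ((ε / 2 : ℝ) : ℂ) * Complex.I, ⟨h ?_, ht.update_imaginary hk _⟩, ?_⟩
  · rw [Real.dist_eq, sub_zero, abs_of_pos (by positivity)]; linarith
  · simp [hε.ne']

end

end BurgersHopf

namespace BurgersHopf

noncomputable section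

/-! The determinant is `c ^ N` times the Hankel determinant of the moments, hence by Andréief `c ^ N
/ N!` times the integral of `Δ(x) ^ 2 ∏ exp ξ(t, x_i)`, with `Δ` the Vandermonde determinant. Under
this integral `∂/∂t_k` inserts the power sum `p_k`. With `p_0 = N` and `m = s + 1`, the operator of
index `s` inserts `∑ k t_k p_{k+s} + ∑_{k<m} p_k p_{m-1-k}`, which turns the integrand into the
divergence `∑_i ∂_i (x_i ^ m Δ ^ 2 ∏ exp ξ)`, so the integral vanishes. No `N`-fold integral is
needed: `momentFunctional` extends products of one-variable moments linearly. The analysis is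
one-variable (`hasDerivWithinAt_moment`, `hasSum_moment`); the algebra is
`sum_pderiv_X_pow_mul_vandermonde_sq` and `momentFunctional_vandermonde_sq`. -/

/-- The moment `∫ x ^ n * exp (ξ(t, x)) dx`. -/
def moment (n : ℕ) (t : ℕ → ℂ) : ℂ := ∫ x : ℝ, (x : ℂ) ^ n * Complex.exp (xi t x)

/-! ### Differentiation of moments in the times -/

/-- Mean value inequality on a half-plane containing `0` and `w`. Only `w.re` enters the
exponential, since imaginary shifts of a time cost nothing. -/
lemma norm_exp_sub_one_le_exp_max (w : ℂ) :
    ‖Complex.exp w - 1‖ ≤ Real.exp (max 0 w.re) * ‖w‖ := by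
  have h := Convex.norm_image_sub_le_of_norm_hasDerivWithin_le (𝕜 := ℂ) (f := Complex.exp)
    (f' := Complex.exp) (s := {z : ℂ | z.re ≤ max 0 w.re}) (x := 0) (y := w)
    (C := Real.exp (max 0 w.re))
    (fun z _ => (Complex.hasDerivAt_exp z).hasDerivWithinAt)
    (fun z hz => by rw [Complex.norm_exp]; exact Real.exp_le_exp.2 hz)
    (convex_halfSpace_re_le _) (by simp) (by simp)
  simpa using h

/-- Supplies a dominating time. If no point of the slice lies further right, `t k` itself is
maximal. -/
lemma exists_upper_mem_slice {t : ℕ → ℂ} (ht : Convergent t) (k : ℕ) :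
    ∃ A ∈ slice k t, (t k).re ≤ A.re ∧
      ∀ᶠ z in nhdsWithin (t k) (slice k t), z.re ≤ A.re := by
  by_cases h : ∃ A ∈ slice k t, (t k).re < A.re
  · obtain ⟨A, hA, hlt⟩ := h
    refine ⟨A, hA, hlt.le, nhdsWithin_le_nhds ?_⟩
    exact (Complex.continuous_re.tendsto (t k)).eventually (eventually_le_nhds hlt)
  · push Not at h
    refine ⟨t k, by simpa [slice] using ht, le_rfl, ?_⟩
    filter_upwards [self_mem_nhdsWithin] with z hz using h z hz

lemma exists_lower_mem_slice {t : ℕ → ℂ} (ht : Convergent t) (k : ℕ) :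
    ∃ A ∈ slice k t, A.re ≤ (t k).re ∧
      ∀ᶠ z in nhdsWithin (t k) (slice k t), A.re ≤ z.re := by
  by_cases h : ∃ A ∈ slice k t, A.re < (t k).re
  · obtain ⟨A, hA, hlt⟩ := h
    refine ⟨A, hA, hlt.le, nhdsWithin_le_nhds ?_⟩
    exact (Complex.continuous_re.tendsto (t k)).eventually (eventually_ge_nhds hlt)
  · push Not at h
    refine ⟨t k, by simpa [slice] using ht, le_rfl, ?_⟩
    filter_upwards [self_mem_nhdsWithin] with z hz using h z hz

lemma exp_max_mul_le {a b h y : ℝ} (ha : 0 ≤ a) (hb : b ≤ 0) (hha : h ≤ a) (hhb : b ≤ h) :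
    Real.exp (max 0 (h * y)) ≤ Real.exp (a * y) + Real.exp (b * y) := by
  rcases le_total 0 y with hy | hy
  · refine le_add_of_le_of_nonneg (Real.exp_le_exp.2 (max_le (by positivity) ?_))
      (Real.exp_pos _).le
    exact mul_le_mul_of_nonneg_right hha hy
  · refine le_add_of_nonneg_of_le (Real.exp_pos _).le (Real.exp_le_exp.2 (max_le ?_ ?_))
    · exact mul_nonneg_of_nonpos_of_nonpos hb hy
    · exact mul_le_mul_of_nonpos_right hhb hy

/-- The slice need not be a neighbourhood of `t k`. Difference quotients are dominated by the
integrands of order `n + k` at two slice points `A`, `B` whose real parts bracket those of nearby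
`z`. -/
lemma hasDerivWithinAt_moment {t : ℕ → ℂ} (ht : Convergent t) {k : ℕ} (hk : 1 ≤ k) (n : ℕ) :
    HasDerivWithinAt (fun z => moment n (Function.update t k z)) (moment (n + k) t)
      (slice k t) (t k) := by
  obtain ⟨A, hA, hA0, hA1⟩ := exists_upper_mem_slice ht k
  obtain ⟨B, hB, hB0, hB1⟩ := exists_lower_mem_slice ht k
  rw [hasDerivWithinAt_iff_tendsto_slope]
  have hle : nhdsWithin (t k) (slice k t \ {t k}) ≤ nhdsWithin (t k) (slice k t) :=
    nhdsWithin_mono _ Set.sdiff_subset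
  have hself : ∀ᶠ z in nhdsWithin (t k) (slice k t \ {t k}), z ∈ slice k t ∧ z ≠ t k :=
    self_mem_nhdsWithin
  have hint : ∀ z ∈ slice k t, ∀ m : ℕ, Integrable fun x : ℝ =>
      (x : ℂ) ^ m * Complex.exp (xi (Function.update t k z) x) := fun z hz m => hz.moments m
  have htend := tendsto_integral_filter_of_dominated_convergence (μ := volume)
    (l := nhdsWithin (t k) (slice k t \ {t k}))
    (F := fun z (x : ℝ) => (z - t k)⁻¹ * ((x : ℂ) ^ n *
      Complex.exp (xi (Function.update t k z) x) - (x : ℂ) ^ n * Complex.exp (xi t x)))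
    (f := fun x : ℝ => (x : ℂ) ^ (n + k) * Complex.exp (xi t x))
    (fun x : ℝ => ‖(x : ℂ) ^ (n + k) * Complex.exp (xi (Function.update t k A) x)‖ +
      ‖(x : ℂ) ^ (n + k) * Complex.exp (xi (Function.update t k B) x)‖) ?_ ?_ ?_ ?_
  · refine htend.congr' ?_
    filter_upwards [hself] with z hz
    rw [slope_def_field, integral_const_mul, integral_sub (hint z hz.1 n) (ht.moments n)]
    simp only [moment, Function.update_eq_self]
    field_simp
  · filter_upwards [hself] with z hz
    exact (((hint z hz.1 n).sub (ht.moments n)).const_mul _).aestronglyMeasurable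
  · filter_upwards [hself, hA1.filter_mono hle, hB1.filter_mono hle] with z hz hzA hzB
    refine Filter.Eventually.of_forall fun x => ?_
    have hz0 : z - t k ≠ 0 := sub_ne_zero.2 hz.2
    have hre : ((z - t k) * (x : ℂ) ^ k).re = (z.re - (t k).re) * x ^ k := by
      rw [← Complex.ofReal_pow, Complex.re_mul_ofReal, Complex.sub_re]
    have hnorm : ∀ C : ℂ, ‖(x : ℂ) ^ (n + k) * Complex.exp (xi (Function.update t k C) x)‖ =
        |x| ^ (n + k) * ‖Complex.exp (xi t x)‖ * Real.exp ((C.re - (t k).re) * x ^ k) := by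
      intro C
      rw [ht.xi_update hk, Complex.exp_add, ← Complex.ofReal_pow x k]
      simp only [norm_mul, norm_pow, Complex.norm_real, Real.norm_eq_abs, Complex.norm_exp,
        Complex.re_mul_ofReal, Complex.sub_re]
      ring
    have hexp := exp_max_mul_le (y := x ^ k) (sub_nonneg.2 hA0) (sub_nonpos.2 hB0)
      (sub_le_sub_right hzA _) (sub_le_sub_right hzB _)
    have h1 := (norm_exp_sub_one_le_exp_max ((z - t k) * (x : ℂ) ^ k)).trans
      (mul_le_mul_of_nonneg_right (hexp.trans_eq' (by rw [hre])) (norm_nonneg _))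
    have h2 : (z - t k)⁻¹ * ((x : ℂ) ^ n * Complex.exp (xi (Function.update t k z) x) -
        (x : ℂ) ^ n * Complex.exp (xi t x)) = (z - t k)⁻¹ * ((x : ℂ) ^ n *
          Complex.exp (xi t x) * (Complex.exp ((z - t k) * (x : ℂ) ^ k) - 1)) := by
      rw [ht.xi_update hk, Complex.exp_add]; ring
    rw [h2, norm_mul, norm_mul, hnorm, hnorm, norm_inv]
    rw [inv_mul_le_iff₀ (norm_pos_iff.2 hz0)]
    refine (mul_le_mul_of_nonneg_left h1 (norm_nonneg _)).trans (le_of_eq ?_)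
    simp only [norm_mul, norm_pow, Complex.norm_real, Real.norm_eq_abs, pow_add]
    ring
  · exact (hint A hA _).norm.add (hint B hB _).norm
  · refine Filter.Eventually.of_forall fun x => ?_
    have hd : HasDerivAt (fun z : ℂ => (x : ℂ) ^ n *
        (Complex.exp (xi t x) * Complex.exp ((z - t k) * (x : ℂ) ^ k)))
        ((x : ℂ) ^ (n + k) * Complex.exp (xi t x)) (t k) := by
      have h := ((((hasDerivAt_id (t k)).sub_const (t k)).mul_const ((x : ℂ) ^ k)).cexp.const_mul
        (Complex.exp (xi t x))).const_mul ((x : ℂ) ^ n)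
      refine h.congr_deriv ?_
      simp [pow_add]
      ring
    have h := (hasDerivWithinAt_iff_tendsto_slope.1
      (hd.hasDerivWithinAt (s := slice k t)))
    refine h.congr fun z => ?_
    rw [slope_def_field, ht.xi_update hk, Complex.exp_add]
    simp
    ring

/-- A formula valid only on the domain of convergence may be differentiated, because `pderiv`
samples nothing else. -/
lemma pderiv_congr {F G : (ℕ → ℂ) → ℂ} (h : Set.EqOn F G {t | Convergent t}) {t : ℕ → ℂ}
    (ht : Convergent t) (k : ℕ) : pderiv k F t = pderiv k G t :=
  derivWithin_congr (fun _ hz => h hz) (by simpa using h ht)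

lemma HasPartial.congr {F G : (ℕ → ℂ) → ℂ} (h : Set.EqOn F G {t | Convergent t}) {t : ℕ → ℂ}
    (ht : Convergent t) {k : ℕ} (hG : HasPartial k G t) : HasPartial k F t :=
  DifferentiableWithinAt.congr hG (fun _ hz => h hz) (by simpa using h ht)

/-! ### Integration by parts for one moment -/

lemma Convergent.summable_deriv_bound {t : ℕ → ℂ} (ht : Convergent t) (r : ℝ) (hr : 1 ≤ r) :
    Summable fun k : ℕ => (k : ℝ) * ‖t k‖ * r ^ (k - 1) := by
  refine Summable.of_nonneg_of_le (fun k => by positivity) (fun k => ?_) (ht.summable_weight r)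
  rw [abs_of_nonneg (by linarith)]
  gcongr
  exact Nat.sub_le k 1

lemma Convergent.hasSum_deriv_xi {t : ℕ → ℂ} (ht : Convergent t) (x : ℝ) :
    ∃ d : ℂ, HasSum (fun k : ℕ => (k : ℂ) * t k * (x : ℂ) ^ (k - 1)) d ∧
      HasDerivAt (fun y : ℝ => xi t y) d x := by
  -- Room around `x` for termwise differentiation; `1 ≤ r` is needed for `r ^ (k - 1) ≤ r ^ k`.
  set r := |x| + 1
  have hu := ht.summable_deriv_bound r (by simp [r])
  have hb : ∀ (k : ℕ) (y : ℝ), |y| < r →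
      ‖(k : ℂ) * t k * (y : ℂ) ^ (k - 1)‖ ≤ (k : ℝ) * ‖t k‖ * r ^ (k - 1) := by
    intro k y hy
    simp only [norm_mul, norm_pow, Complex.norm_real, Real.norm_eq_abs, Complex.norm_natCast]
    gcongr
  have hx : |x| < r := by simp [r]
  have hs : Summable fun k : ℕ => (k : ℂ) * t k * (x : ℂ) ^ (k - 1) :=
    Summable.of_norm_bounded hu fun k => hb k x hx
  refine ⟨_, hs.hasSum, ?_⟩
  have h := hasDerivAt_tsum_of_isPreconnected (𝕜 := ℝ) (F := ℂ)
    (g := fun k y => t (k + 1) * (y : ℂ) ^ (k + 1))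
    (g' := fun k y => ((k + 1 : ℕ) : ℂ) * t (k + 1) * (y : ℂ) ^ (k + 1 - 1))
    (t := Set.Ioo (-r) r) (y₀ := x) (y := x)
    ((summable_nat_add_iff 1).2 hu) isOpen_Ioo isPreconnected_Ioo
    (fun k y _ => by
      have h := (((hasDerivAt_id y).ofReal_comp).pow (k + 1)).const_mul (t (k + 1))
      refine h.congr_deriv ?_
      simp; ring)
    (fun k y hy => hb (k + 1) y (abs_lt.2 hy)) (abs_lt.1 hx) (ht.summable_xi x) (abs_lt.1 hx)
  refine h.congr_deriv ?_
  rw [hs.tsum_eq_zero_add]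
  simp

/-- Integration by parts: `∫ (x ^ n * exp ξ)' dx = 0`, with `ξ'` expanded into its power series. -/
lemma hasSum_moment {t : ℕ → ℂ} (ht : Convergent t) (n : ℕ) :
    HasSum (fun k : ℕ => (k : ℂ) * t k * moment (n + (k - 1)) t)
      (-((n : ℂ) * moment (n - 1) t)) := by
  choose d hd hderiv using ht.hasSum_deriv_xi
  -- Reduces the bound for `ξ'` to the `weighted` and `moments` conditions.
  have hpow : ∀ (x : ℝ) (k : ℕ), |x| ^ (k - 1) ≤ 1 + |x| ^ k := by
    intro x k
    rcases le_total |x| 1 with h | h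
    · exact (pow_le_one₀ (abs_nonneg x) h).trans (le_add_of_nonneg_right (by positivity))
    · exact (pow_le_pow_right₀ h (by omega)).trans (le_add_of_nonneg_left zero_le_one)
  have hs0 : Summable fun k : ℕ => (k : ℝ) * ‖t k‖ := by
    simpa using ht.summable_weight 1
  have hbs : ∀ x : ℝ, HasSum (fun k : ℕ => (k : ℝ) * ‖t k‖ * (1 + |x| ^ k) *
      ‖(x : ℂ) ^ n * Complex.exp (xi t x)‖)
      (((∑' k : ℕ, (k : ℝ) * ‖t k‖) + ∑' k : ℕ, (k : ℝ) * ‖t k‖ * |x| ^ k) *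
        ‖(x : ℂ) ^ n * Complex.exp (xi t x)‖) := by
    intro x
    refine HasSum.mul_right _ ?_
    simpa only [mul_add, mul_one] using hs0.hasSum.add (ht.summable_weight x).hasSum
  have hbi : Integrable fun x : ℝ => ((∑' k : ℕ, (k : ℝ) * ‖t k‖) +
      ∑' k : ℕ, (k : ℝ) * ‖t k‖ * |x| ^ k) * ‖(x : ℂ) ^ n * Complex.exp (xi t x)‖ := by
    simp only [add_mul]
    exact ((ht.moments n).norm.const_mul _).add (ht.weighted n)
  have hFd : ∀ x : ℝ, HasSum (fun k : ℕ => (k : ℂ) * t k *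
      ((x : ℂ) ^ (n + (k - 1)) * Complex.exp (xi t x)))
      (d x * ((x : ℂ) ^ n * Complex.exp (xi t x))) := by
    intro x
    refine ((hd x).mul_right ((x : ℂ) ^ n * Complex.exp (xi t x))).congr_fun fun k => ?_
    rw [pow_add]; ring
  have hFb : ∀ (k : ℕ) (x : ℝ), ‖(k : ℂ) * t k *
      ((x : ℂ) ^ (n + (k - 1)) * Complex.exp (xi t x))‖ ≤ (k : ℝ) * ‖t k‖ * (1 + |x| ^ k) *
      ‖(x : ℂ) ^ n * Complex.exp (xi t x)‖ := by
    intro k x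
    have : ‖(k : ℂ) * t k * ((x : ℂ) ^ (n + (k - 1)) * Complex.exp (xi t x))‖ =
        (k : ℝ) * ‖t k‖ * |x| ^ (k - 1) * ‖(x : ℂ) ^ n * Complex.exp (xi t x)‖ := by
      simp only [norm_mul, norm_pow, Complex.norm_real, Real.norm_eq_abs, Complex.norm_natCast,
        pow_add]
      ring
    rw [this]
    gcongr
    exact hpow x k
  have hmeas : ∀ k : ℕ, AEStronglyMeasurable (fun x : ℝ => (k : ℂ) * t k *
      ((x : ℂ) ^ (n + (k - 1)) * Complex.exp (xi t x))) volume :=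
    fun k => ((ht.moments _).const_mul _).aestronglyMeasurable
  have hsum := hasSum_integral_of_dominated_convergence _ hmeas
    (fun k => Filter.Eventually.of_forall (hFb k))
    (Filter.Eventually.of_forall fun x => (hbs x).summable)
    (hbi.congr (Filter.Eventually.of_forall fun x => (hbs x).tsum_eq.symm))
    (Filter.Eventually.of_forall hFd)
  -- `d` was obtained by choice; measurability comes from the partial sums.
  have hdc : AEStronglyMeasurable (fun x : ℝ => d x * ((x : ℂ) ^ n * Complex.exp (xi t x)))
      volume :=
    aestronglyMeasurable_of_tendsto_ae Filter.atTop
      (f := fun N (x : ℝ) => ∑ k ∈ Finset.range N, (k : ℂ) * t k *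
        ((x : ℂ) ^ (n + (k - 1)) * Complex.exp (xi t x)))
      (fun N => Finset.aestronglyMeasurable_fun_sum _ fun k _ => hmeas k)
      (Filter.Eventually.of_forall fun x => (hFd x).tendsto_sum_nat)
  have hdi : Integrable fun x : ℝ => d x * ((x : ℂ) ^ n * Complex.exp (xi t x)) :=
    hbi.mono' hdc (Filter.Eventually.of_forall fun x => by
      rw [← (hFd x).tsum_eq, ← (hbs x).tsum_eq]
      exact tsum_of_norm_bounded (hbs x).summable.hasSum fun k => hFb k x)
  have hzero := integral_eq_zero_of_hasDerivAt_of_integrable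
    (f := fun x : ℝ => (x : ℂ) ^ n * Complex.exp (xi t x))
    (f' := fun x : ℝ => (n : ℂ) * ((x : ℂ) ^ (n - 1) * Complex.exp (xi t x)) +
      d x * ((x : ℂ) ^ n * Complex.exp (xi t x)))
    (fun x => by
      refine (((hasDerivAt_id x).ofReal_comp.pow n).mul (hderiv x).cexp).congr_deriv ?_
      simp; ring)
    (((ht.moments _).const_mul _).add hdi) (ht.moments n)
  rw [integral_add ((ht.moments _).const_mul _) hdi, integral_const_mul, add_comm] at hzero
  rw [eq_neg_of_add_eq_zero_left hzero] at hsum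
  refine hsum.congr_fun fun k => ?_
  rw [integral_const_mul, moment]

/-! ### The moment functional on polynomials -/

open MvPolynomial in
/-- The linear functional on polynomials in `N` variables that takes `∏ x_i ^ a_i` to the product
of the moments of orders `a_i`, that is, integration against `∏ exp (ξ(t, x_i)) dx_i`. -/
def momentFunctional (N : ℕ) (t : ℕ → ℂ) : MvPolynomial (Fin N) ℂ →ₗ[ℂ] ℂ :=
  (basisMonomials (Fin N) ℂ).constr ℂ fun a => ∏ i, moment (a i) t

section

open MvPolynomial

variable {N : ℕ}

lemma momentFunctional_monomial (t : ℕ → ℂ) (a : Fin N →₀ ℕ) (r : ℂ) :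
    momentFunctional N t (monomial a r) = r * ∏ i, moment (a i) t := by
  have h : monomial a r = r • basisMonomials (Fin N) ℂ a := by
    simp [smul_monomial]
  rw [h, map_smul, momentFunctional, Module.Basis.constr_basis, smul_eq_mul]

lemma momentFunctional_X_pow_mul_monomial (t : ℕ → ℂ) (a : Fin N →₀ ℕ) (r : ℂ) (i : Fin N)
    (k : ℕ) : momentFunctional N t (X i ^ k * monomial a r) =
      r * ((∏ j ∈ Finset.univ.erase i, moment (a j) t) * moment (a i + k) t) := by
  rw [X_pow_eq_monomial, monomial_mul, momentFunctional_monomial, one_mul,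
    ← Finset.prod_erase_mul _ _ (Finset.mem_univ i)]
  congr 2
  · refine Finset.prod_congr rfl fun j hj => ?_
    rw [Finsupp.add_apply, Finsupp.single_eq_of_ne (Finset.ne_of_mem_erase hj), zero_add]
  · simp [add_comm]

/-- Product rule: each factor in turn has its order raised by `k`, which is multiplication by `∑ x_i
^ k`. -/
lemma hasDerivWithinAt_momentFunctional {t : ℕ → ℂ} (ht : Convergent t) {k : ℕ} (hk : 1 ≤ k)
    (P : MvPolynomial (Fin N) ℂ) :
    HasDerivWithinAt (fun z => momentFunctional N (Function.update t k z) P)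
      (momentFunctional N t (psum (Fin N) ℂ k * P)) (slice k t) (t k) := by
  induction P using MvPolynomial.induction_on' with
  | monomial a r =>
    have h := (HasDerivWithinAt.fun_finsetProd (u := Finset.univ) fun (i : Fin N) _ =>
      hasDerivWithinAt_moment ht hk (a i)).const_mul r
    simp only [Function.update_eq_self] at h
    simp only [momentFunctional_monomial]
    refine h.congr_deriv ?_
    simp only [psum, Finset.sum_mul, map_sum, momentFunctional_X_pow_mul_monomial,
      Finset.mul_sum, smul_eq_mul]
  | add P Q hP hQ =>
    simpa only [mul_add, map_add] using hP.fun_add hQ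

lemma pderiv_momentFunctional {F : (ℕ → ℂ) → ℂ} {P : MvPolynomial (Fin N) ℂ}
    (h : Set.EqOn F (fun t => momentFunctional N t P) {t | Convergent t}) {k : ℕ} (hk : 1 ≤ k) :
    Set.EqOn (pderiv k F) (fun t => momentFunctional N t (psum (Fin N) ℂ k * P))
      {t | Convergent t} := by
  intro t ht
  rw [pderiv_congr h ht]
  exact (hasDerivWithinAt_momentFunctional ht hk P).derivWithin (uniqueDiffWithinAt_slice ht hk)

lemma foldr_pderiv_momentFunctional {F : (ℕ → ℂ) → ℂ} {P : MvPolynomial (Fin N) ℂ}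
    (h : Set.EqOn F (fun t => momentFunctional N t P) {t | Convergent t}) (l : List ℕ)
    (hl : ∀ j ∈ l, 1 ≤ j) :
    ∃ Q : MvPolynomial (Fin N) ℂ, Set.EqOn (l.foldr pderiv F)
      (fun t => momentFunctional N t Q) {t | Convergent t} := by
  induction l with
  | nil => exact ⟨P, h⟩
  | cons k l ih =>
    obtain ⟨Q, hQ⟩ := ih fun j hj => hl j (List.mem_cons_of_mem _ hj)
    exact ⟨_, pderiv_momentFunctional hQ (hl k List.mem_cons_self)⟩

lemma smooth_of_eqOn_momentFunctional {F : (ℕ → ℂ) → ℂ} {P : MvPolynomial (Fin N) ℂ}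
    (h : Set.EqOn F (fun t => momentFunctional N t P) {t | Convergent t}) : Smooth F := by
  intro l hl k hk t ht
  obtain ⟨Q, hQ⟩ := foldr_pderiv_momentFunctional h l hl
  exact HasPartial.congr hQ ht
    (hasDerivWithinAt_momentFunctional ht hk Q).differentiableWithinAt

/-- The Virasoro constraints in the form `∑_k k t_k p_{k+m-1} = -∑_i ∂_i x_i ^ m` under the
moment functional. -/
lemma hasSum_momentFunctional {t : ℕ → ℂ} (ht : Convergent t) (m : ℕ)
    (P : MvPolynomial (Fin N) ℂ) :
    HasSum (fun k : ℕ => (k : ℂ) * t k *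
        momentFunctional N t (psum (Fin N) ℂ (m + (k - 1)) * P))
      (-momentFunctional N t (∑ i, MvPolynomial.pderiv i (X i ^ m * P))) := by
  induction P using MvPolynomial.induction_on' with
  | monomial a r =>
    have h := hasSum_sum (s := Finset.univ) fun (i : Fin N) _ =>
      (hasSum_moment ht (a i + m)).mul_left
        (r * ∏ j ∈ Finset.univ.erase i, moment (a j) t)
    convert! h using 1
    · funext k
      simp only [psum, Finset.sum_mul, map_sum, momentFunctional_X_pow_mul_monomial,
        Finset.mul_sum]
      refine Finset.sum_congr rfl fun i _ => ?_
      rw [add_assoc]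
      ring
    · rw [map_sum, ← Finset.sum_neg_distrib]
      refine Finset.sum_congr rfl fun i _ => ?_
      rw [X_pow_eq_monomial, monomial_mul, pderiv_monomial, momentFunctional_monomial,
        ← Finset.prod_erase_mul _ _ (Finset.mem_univ i)]
      have h1 : ∏ j ∈ Finset.univ.erase i,
          moment ((Finsupp.single i m + a - Finsupp.single i 1 : Fin N →₀ ℕ) j) t =
          ∏ j ∈ Finset.univ.erase i, moment (a j) t := by
        refine Finset.prod_congr rfl fun j hj => ?_
        have hj' := Finset.ne_of_mem_erase hj
        simp [Finsupp.single_eq_of_ne hj']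
      rw [h1]
      simp [add_comm m]
      ring
  | add P Q hP hQ =>
    have h := hP.add hQ
    simp only [mul_add, map_add, Finset.sum_add_distrib, neg_add] at h ⊢
    exact h

/-! ### Divergence of the squared Vandermonde determinant -/

lemma derivation_sum_apply {R A ι : Type*} [CommRing R] [CommRing A] [Algebra R A]
    (D : ι → Derivation R A A) (s : Finset ι) (P : A) : (∑ i ∈ s, D i) P = ∑ i ∈ s, D i P :=
  (congr_fun (map_sum (Derivation.coeFnAddMonoidHom (R := R) (A := A) (M := A)) D s) P).trans
    (Finset.sum_apply P s _)

/-- Additivity of logarithmic derivatives, without division. -/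
lemma derivation_eq_mul_prod {R A ι : Type*} [CommRing R] [CommRing A] [Algebra R A]
    (D : Derivation R A A) (s : Finset ι) (f h : ι → A) (hf : ∀ i ∈ s, D (f i) = f i * h i) :
    D (∏ i ∈ s, f i) = (∏ i ∈ s, f i) * ∑ i ∈ s, h i := by
  classical
  induction s using Finset.induction_on with
  | empty => simp
  | insert i s hi ih =>
    rw [Finset.prod_insert hi, Finset.sum_insert hi, D.leibniz,
      ih fun j hj => hf j (Finset.mem_insert_of_mem hj), hf i (Finset.mem_insert_self _ _)]
    simp only [smul_eq_mul]
    ring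

/-- The Vandermonde determinant in the variables of the polynomial ring. -/
def vandermondePoly (N : ℕ) : MvPolynomial (Fin N) ℂ :=
  (Matrix.vandermonde fun i : Fin N => (X i : MvPolynomial (Fin N) ℂ)).det

lemma sum_sum_eq_diag_add_two_mul {A : Type*} [CommRing A] (f : Fin N → Fin N → A)
    (hf : ∀ i j, f i j = f j i) :
    ∑ i, ∑ j, f i j = ∑ i, f i i + 2 * ∑ i, ∑ j ∈ Finset.Ioi i, f i j := by
  have h1 : ∀ i : Fin N, ∑ j, f i j =
      f i i + ∑ j ∈ Finset.Ioi i, f i j + ∑ j ∈ Finset.Iio i, f i j := by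
    intro i
    have h : (Finset.univ : Finset (Fin N)) =
        insert i (Finset.Ioi i ∪ Finset.Iio i) := by
      ext j
      simp only [Finset.mem_univ, Finset.mem_insert, Finset.mem_union, Finset.mem_Ioi,
        Finset.mem_Iio, true_iff]
      rcases lt_trichotomy i j with h | h | h <;> simp [h]
    rw [h, Finset.sum_insert (by simp), Finset.sum_union, add_assoc]
    exact Finset.disjoint_left.2 fun j hj hj' =>
      lt_asymm (Finset.mem_Ioi.1 hj) (Finset.mem_Iio.1 hj')
  have h2 : ∑ i, ∑ j ∈ Finset.Iio i, f i j = ∑ i, ∑ j ∈ Finset.Ioi i, f i j := by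
    rw [Finset.sum_comm' (t' := Finset.univ) (s' := fun j => Finset.Ioi j) (by simp)]
    exact Finset.sum_congr rfl fun i _ => Finset.sum_congr rfl fun j _ => hf j i
  simp only [h1, Finset.sum_add_distrib, h2]
  ring

/-- With `D = ∑ x_i ^ m ∂_i`, one has `D (x_j - x_i) = (x_j - x_i) h i j`. The square of `Δ` thus
yields twice the sum of `h i j` over `i < j`, and `∂_i x_i ^ m = h i i` supplies the diagonal; the
full double sum is `∑ p_k p_{m-1-k}`. -/
lemma sum_pderiv_X_pow_mul_vandermonde_sq (m : ℕ) :
    ∑ i, MvPolynomial.pderiv i (X i ^ m * vandermondePoly N ^ 2) =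
      (∑ k ∈ Finset.range m, psum (Fin N) ℂ k * psum (Fin N) ℂ (m - 1 - k)) *
        vandermondePoly N ^ 2 := by
  let D : Derivation ℂ (MvPolynomial (Fin N) ℂ) (MvPolynomial (Fin N) ℂ) :=
    mkDerivation ℂ fun i => X i ^ m
  let h : Fin N → Fin N → MvPolynomial (Fin N) ℂ :=
    fun i j => ∑ k ∈ Finset.range m, X i ^ k * X j ^ (m - 1 - k)
  have hsymm : ∀ i j, h i j = h j i := by
    intro i j
    simp only [h]
    rw [← Finset.sum_range_reflect]
    refine Finset.sum_congr rfl fun k hk => ?_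
    have : m - 1 - (m - 1 - k) = k := by have := Finset.mem_range.1 hk; omega
    rw [this, mul_comm]
  have hD : ∀ P, D P = ∑ i, X i ^ m * MvPolynomial.pderiv i P := by
    intro P
    have : D = ∑ i, (X i ^ m : MvPolynomial (Fin N) ℂ) • MvPolynomial.pderiv i := by
      refine derivation_ext fun j => ?_
      rw [mkDerivation_X, derivation_sum_apply]
      simp [pderiv_X, Pi.single_apply]
    rw [this, derivation_sum_apply]
    simp
  have hDV : D (vandermondePoly N) =
      vandermondePoly N * ∑ i, ∑ j ∈ Finset.Ioi i, h i j := by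
    rw [vandermondePoly, Matrix.det_vandermonde]
    refine derivation_eq_mul_prod D _ _ _ fun i _ =>
      derivation_eq_mul_prod D _ _ _ fun j _ => ?_
    rw [map_sub, mkDerivation_X, mkDerivation_X, hsymm, mul_comm]
    exact ((Commute.all _ _).geom_sum₂_mul m).symm
  have hdiag : ∀ i, MvPolynomial.pderiv i (X i ^ m : MvPolynomial (Fin N) ℂ) = h i i := by
    intro i
    simp only [h]
    rw [geom_sum₂_self]
    simp
  have hpp : ∑ k ∈ Finset.range m, psum (Fin N) ℂ k * psum (Fin N) ℂ (m - 1 - k) =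
      ∑ i, ∑ j, h i j := by
    simp only [psum, Finset.sum_mul_sum, h]
    rw [Finset.sum_comm]
    exact Finset.sum_congr rfl fun i _ => Finset.sum_comm
  have h1 : ∑ i, MvPolynomial.pderiv i (X i ^ m * vandermondePoly N ^ 2) =
      D (vandermondePoly N ^ 2) + (∑ i, h i i) * vandermondePoly N ^ 2 := by
    rw [hD, Finset.sum_mul, ← Finset.sum_add_distrib]
    refine Finset.sum_congr rfl fun i _ => ?_
    rw [Derivation.leibniz, hdiag, smul_eq_mul, smul_eq_mul]
    ring
  rw [h1, pow_two, D.leibniz, hDV, hpp, sum_sum_eq_diag_add_two_mul h hsymm]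
  simp only [smul_eq_mul]
  ring

/-! ### The τ-function as a moment functional -/

/-- The Andréief identity for the Hankel determinant of the moments. -/
lemma momentFunctional_vandermonde_sq (t : ℕ → ℂ) :
    momentFunctional N t (vandermondePoly N ^ 2) =
      (N.factorial : ℂ) * (Matrix.of fun i j : Fin N => moment (i + j) t).det := by
  have h1 : ∀ σ τ : Equiv.Perm (Fin N), momentFunctional N t
      ((∏ i, (X i : MvPolynomial (Fin N) ℂ) ^ (σ i : ℕ)) * ∏ i, X i ^ (τ i : ℕ)) =
        ∏ i, moment (σ i + τ i) t := by
    intro σ τ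
    have h : (∏ i, (X i : MvPolynomial (Fin N) ℂ) ^ (σ i : ℕ)) * ∏ i, X i ^ (τ i : ℕ) =
        monomial (Finsupp.equivFunOnFinite.symm fun i => (σ i + τ i : ℕ)) 1 := by
      rw [← Finset.prod_mul_distrib, monomial_eq, C_1, one_mul,
        Finsupp.prod_fintype _ _ (by simp)]
      simp [pow_add]
    rw [h, momentFunctional_monomial, one_mul]
    simp
  have h2 : vandermondePoly N = ∑ σ : Equiv.Perm (Fin N),
      (((Equiv.Perm.sign σ : ℤ) : ℂ)) • ∏ i, (X i : MvPolynomial (Fin N) ℂ) ^ (σ i : ℕ) := by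
    rw [vandermondePoly, ← Matrix.det_transpose, Matrix.det_apply']
    refine Finset.sum_congr rfl fun σ _ => ?_
    rw [smul_eq_C_mul]
    simp [Matrix.vandermonde]
  rw [pow_two, h2, Finset.sum_mul_sum, map_sum]
  simp only [map_sum, smul_mul_smul_comm, map_smul, h1, smul_eq_mul]
  -- For fixed `σ` the sum over `τ` is a row-permuted determinant, whose sign cancels that of `σ`;
  -- so `N!` equal terms arise.
  have h3 : ∀ σ : Equiv.Perm (Fin N), ∑ τ : Equiv.Perm (Fin N),
      ((Equiv.Perm.sign σ : ℤ) : ℂ) * ((Equiv.Perm.sign τ : ℤ) : ℂ) *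
        ∏ i, moment (σ i + τ i) t =
      (Matrix.of fun i j : Fin N => moment (i + j) t).det := by
    intro σ
    have h := Matrix.det_permute σ (Matrix.of fun i j : Fin N => moment (i + j) t)
    rw [← Matrix.det_transpose, Matrix.det_apply'] at h
    have h4 : ((Equiv.Perm.sign σ : ℤ) : ℂ) * ((Equiv.Perm.sign σ : ℤ) : ℂ) = 1 := by
      rcases Int.units_eq_one_or (Equiv.Perm.sign σ) with h | h <;> simp [h]
    simp only [mul_assoc]
    rw [← Finset.mul_sum]
    have h5 : ∑ τ : Equiv.Perm (Fin N), ((Equiv.Perm.sign τ : ℤ) : ℂ) *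
        ∏ i, moment (σ i + τ i) t = ((Equiv.Perm.sign σ : ℤ) : ℂ) *
          (Matrix.of fun i j : Fin N => moment (i + j) t).det := by
      rw [← h]
      rfl
    rw [h5, ← mul_assoc, h4, one_mul]
  simp [h3, Fintype.card_perm]

lemma spectralIntegral_const (c : ℂ) (t : ℕ → ℂ) :
    spectralIntegral (fun _ => c) t = c * moment 0 t := by
  simp [spectralIntegral, moment, integral_const_mul]

lemma momentFunctional_single_variable (c : ℂ) (n : ℕ) (t : ℕ → ℂ) :
    momentFunctional 1 t (monomial (Finsupp.single 0 n) c) = c * moment n t := by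
  rw [momentFunctional_monomial]
  simp

lemma iterate_pderiv_spectralIntegral_const (c : ℂ) (n : ℕ) :
    Set.EqOn ((pderiv 1)^[n] (spectralIntegral fun _ => c))
      (fun t => momentFunctional 1 t (monomial (Finsupp.single 0 n) c)) {t | Convergent t} := by
  induction n with
  | zero =>
    intro t _
    simp only [Function.iterate_zero, id_eq]
    rw [spectralIntegral_const, momentFunctional_single_variable]
  | succ n ih =>
    intro t ht
    rw [Function.iterate_succ_apply', pderiv_momentFunctional ih le_rfl ht]
    simp [psum, X, monomial_mul, ← Finsupp.single_add, add_comm]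

lemma tau_spectralIntegral_const (N : ℕ) (c : ℂ) :
    Set.EqOn (tau N (spectralIntegral fun _ => c))
      (fun t => momentFunctional N t (C (c ^ N / (N.factorial : ℂ)) * vandermondePoly N ^ 2))
      {t | Convergent t} := by
  intro t ht
  have h0 : (N.factorial : ℂ) ≠ 0 := by exact_mod_cast N.factorial_ne_zero
  have h1 : (Matrix.of fun i j : Fin N =>
      (pderiv 1)^[(i : ℕ)] ((pderiv 1)^[(j : ℕ)] (spectralIntegral fun _ => c)) t) =
      c • Matrix.of fun i j : Fin N => moment (i + j) t := by
    ext i j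
    rw [Matrix.of_apply, ← Function.iterate_add_apply,
      iterate_pderiv_spectralIntegral_const c _ ht]
    exact momentFunctional_single_variable c _ t
  rw [tau, wronskian, h1, Matrix.det_smul, Fintype.card_fin]
  simp only [← smul_eq_C_mul, map_smul, momentFunctional_vandermonde_sq, smul_eq_mul]
  field_simp

/-! ### The Virasoro operators on moment functionals -/

/-- Here `m = s + 1`. For `s = -1` the Euler sum omits `k = 1`, where the uniform formula has `t_1
p_0 = N t_1`; this is the correction. -/
lemma eulerTerm_eq {F : (ℕ → ℂ) → ℂ} {P : MvPolynomial (Fin N) ℂ}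
    (h : Set.EqOn F (fun t => momentFunctional N t P) {t | Convergent t}) {t : ℕ → ℂ}
    (ht : Convergent t) (m k : ℕ) :
    eulerTerm ((m : ℤ) - 1) F t k = (k : ℂ) * t k *
      momentFunctional N t (psum (Fin N) ℂ (m + (k - 1)) * P) -
      if k = 1 ∧ m = 0 then t 1 * ((N : ℂ) * F t) else 0 := by
  rw [eulerTerm]
  rcases Nat.eq_zero_or_pos k with rfl | hk
  · simp
  by_cases hkm : k = 1 ∧ m = 0
  · obtain ⟨rfl, rfl⟩ := hkm
    have hF : F t = momentFunctional N t P := h ht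
    have : psum (Fin N) ℂ 0 * P = (N : ℂ) • P := by simp [psum_zero, smul_eq_C_mul]
    simp only [Nat.sub_self, zero_add, this, map_smul, hF]
    simp
  · have h1 : ((k : ℤ) + ((m : ℤ) - 1)).toNat = m + (k - 1) := by omega
    rw [if_pos (by omega), if_neg hkm, h1, sub_zero,
      pderiv_momentFunctional h (by omega) ht]

lemma hasSum_eulerTerm {F : (ℕ → ℂ) → ℂ} {P : MvPolynomial (Fin N) ℂ}
    (h : Set.EqOn F (fun t => momentFunctional N t P) {t | Convergent t}) {t : ℕ → ℂ}
    (ht : Convergent t) (m : ℕ) :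
    HasSum (eulerTerm ((m : ℤ) - 1) F t)
      (-momentFunctional N t (∑ i, MvPolynomial.pderiv i (X i ^ m * P)) -
        if m = 0 then t 1 * ((N : ℂ) * F t) else 0) := by
  have h1 := hasSum_ite_eq 1 (if m = 0 then t 1 * ((N : ℂ) * F t) else 0)
  refine ((hasSum_momentFunctional ht m P).sub h1).congr_fun fun k => ?_
  rw [eulerTerm_eq h ht]
  simp only [ite_and]

/-- The two end terms, containing `p_0 = N`, give `2 N ∂/∂t_s`, and merge into `N ^ 2` when `m = 1`.
For `m = 0` the sum is empty and the correction is all that remains. -/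
lemma virasoroRest_eq {F : (ℕ → ℂ) → ℂ} {P : MvPolynomial (Fin N) ℂ}
    (h : Set.EqOn F (fun t => momentFunctional N t P) {t | Convergent t}) {t : ℕ → ℂ}
    (ht : Convergent t) (m : ℕ) :
    virasoroRest N ((m : ℤ) - 1) F t =
      momentFunctional N t ((∑ k ∈ Finset.range m,
        psum (Fin N) ℂ k * psum (Fin N) ℂ (m - 1 - k)) * P) +
        if m = 0 then t 1 * ((N : ℂ) * F t) else 0 := by
  have hF : F t = momentFunctional N t P := h ht
  have h0 : psum (Fin N) ℂ 0 = C (N : ℂ) := by simp [psum_zero]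
  rw [virasoroRest]
  rcases m with _ | _ | s
  · simp; ring
  · have : C (N : ℂ) * C (N : ℂ) * P = ((N : ℂ) ^ 2) • P := by
      rw [smul_eq_C_mul, ← C_mul, pow_two]
    simp only [zero_add, Nat.cast_one, Finset.sum_range_one, h0, Nat.sub_self, Nat.zero_sub, this,
      map_smul, hF]
    simp
  · have h1 : (((s + 1 + 1 : ℕ) : ℤ) - 1).toNat = s + 1 := by omega
    rw [if_neg (by omega), if_neg (by omega), h1, if_neg (by omega), add_zero,
      pderiv_momentFunctional h (by omega) ht, Finset.sum_range_succ, Finset.sum_range_succ',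
      Finset.sum_Ico_eq_sum_range]
    have h2 : ∀ k ∈ Finset.range (s + 1 - 1), pderiv (1 + k) (pderiv (s + 1 - (1 + k)) F) t =
        momentFunctional N t (psum (Fin N) ℂ (k + 1) *
          psum (Fin N) ℂ (s + 1 + 1 - 1 - (k + 1)) * P) := by
      intro k hk
      have hk' := Finset.mem_range.1 hk
      have := pderiv_momentFunctional (pderiv_momentFunctional h (k := s + 1 - (1 + k))
        (by omega)) (k := 1 + k) (by omega) ht
      rw [this, ← mul_assoc, add_comm 1 k]
      rfl
    have h3 : psum (Fin N) ℂ (s + 1) * C (N : ℂ) * P =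
        (N : ℂ) • (psum (Fin N) ℂ (s + 1) * P) := by
      rw [smul_eq_C_mul]; ring
    have h4 : C (N : ℂ) * psum (Fin N) ℂ (s + 1) * P =
        (N : ℂ) • (psum (Fin N) ℂ (s + 1) * P) := by
      rw [smul_eq_C_mul]; ring
    rw [Finset.sum_congr rfl h2]
    simp only [add_mul, Finset.sum_mul, map_add, map_sum, Nat.add_sub_cancel, Nat.sub_zero,
      Nat.sub_self, h0, h3, h4, map_smul, smul_eq_mul]
    ring

end

end

end BurgersHopf

theorem proposition5p2 (N : ℕ) (c : ℂ) :
    BurgersHopf.Smooth (BurgersHopf.spectralIntegral fun _ => c) ∧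
    BurgersHopf.Smooth (BurgersHopf.tau N (BurgersHopf.spectralIntegral fun _ => c)) ∧
    ∀ s : ℤ, -1 ≤ s → ∀ t : ℕ → ℂ, BurgersHopf.Convergent t →
      Summable (BurgersHopf.eulerTerm s
        (BurgersHopf.tau N (BurgersHopf.spectralIntegral fun _ => c)) t) ∧
      BurgersHopf.virasoro N s
        (BurgersHopf.tau N (BurgersHopf.spectralIntegral fun _ => c)) t = 0 := by
  refine ⟨BurgersHopf.smooth_of_eqOn_momentFunctional
    (BurgersHopf.iterate_pderiv_spectralIntegral_const c 0),
    BurgersHopf.smooth_of_eqOn_momentFunctional (BurgersHopf.tau_spectralIntegral_const N c),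
    fun s hs t ht => ?_⟩
  obtain ⟨m, rfl⟩ : ∃ m : ℕ, s = (m : ℤ) - 1 := ⟨(s + 1).toNat, by omega⟩
  have hτ := BurgersHopf.tau_spectralIntegral_const N c
  have hsum := BurgersHopf.hasSum_eulerTerm hτ ht m
  refine ⟨hsum.summable, ?_⟩
  rw [BurgersHopf.virasoro, hsum.tsum_eq, BurgersHopf.virasoroRest_eq hτ ht]
  have h : ∑ i, MvPolynomial.pderiv i ((MvPolynomial.X i : MvPolynomial (Fin N) ℂ) ^ m *
      (MvPolynomial.C (c ^ N / (N.factorial : ℂ)) * BurgersHopf.vandermondePoly N ^ 2)) =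
      (∑ k ∈ Finset.range m, MvPolynomial.psum (Fin N) ℂ k *
        MvPolynomial.psum (Fin N) ℂ (m - 1 - k)) *
        (MvPolynomial.C (c ^ N / (N.factorial : ℂ)) * BurgersHopf.vandermondePoly N ^ 2) := by
    rw [mul_left_comm _ (MvPolynomial.C _),
      ← BurgersHopf.sum_pderiv_X_pow_mul_vandermonde_sq, Finset.mul_sum]
    refine Finset.sum_congr rfl fun i _ => ?_
    rw [mul_left_comm, MvPolynomial.pderiv_C_mul]
  rw [h]
  ring
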